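/- **Notation.** For an integrable function $f$ and real $\rho>0$ put $$(I_{a+}^\rho f)(x)=\frac1{\Gamma(\rho)}\int_a^x\frac{f(y)}{(x-y)^{1-\rho}}\,dy,\qquad (I_{b-}^\rho f)(x)=\frac1{\Gamma(\rho)}\int_x^b\frac{f(y)}{(y-x)^{1-\rho}}\,dy,$$ and $I_{a+}^0f=I_{b-}^0f=f$. For $\mu\in(k-1,k]$ with $k\ge1$ an integer, the Caputo derivatives of order $\mu$ are $${}^C\!D_{a+}^\mu f=I_{a+}^{k-\mu}f^{(k)},\qquad {}^C\!D_{b-}^\mu f=(-1)^kI_{b-}^{k-\mu}f^{(k)}.$$ Let $P_n$ be the Legendre polynomial of degree $n$, let $\hat u_n=\frac{2n+1}2\int_{-1}^1u(x)P_n(x)\,dx$, and for arbitrary real $\alpha,\beta$ let $$P_n^{(\alpha,\beta)}(x)=\frac1{n!}\sum_{\nu=0}^n\binom n\nu(n+\alpha+\beta+1)_\nu\,(\alpha+\nu+1)_{n-\nu}\Big(\frac{x-1}2\Big)^\nu$$ be the generalised Jacobi polynomial, where $(c)_m=c(c+1)\cdots(c+m-1)$; it equals $\frac{(\alpha+1)_n}{n!}\,{}_2F_1\big(-n,n+\alpha+\beta+1;\alpha+1;\frac{1-x}2\big)$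 when $-\alpha\notin\{1,2,\dots\}$. An integral $\int_a^bf\,dg$ with $g$ of bounded variation is the Riemann–Stieltjes integral in which $g(a),g(b)$ are replaced by the one-sided limits $g(a+),g(b-)$, so that jumps of $g$ at the end points do not count. **Theorem.** Let $k\ge1$ be an integer, $\mu\in(k-1,k]$ and $\theta\in(-1,1)$. Let $u:[-1,1]\to\mathbb R$ be such that $u,u',\dots,u^{(k-1)}$ are absolutely continuous on $[-1,1]$, ${}^C\!D_{\theta+}^\mu u$ is of bounded variation on $[\theta,1]$ and ${}^C\!D_{\theta-}^\mu u$ is of bounded variation on $[-1,\theta]$. Since $u^{(k)}$ exists only almost everywhere, this means that the Caputo derivatives coincide almost everywhere with functions of bounded variation; below, the same symbols denote any such functions. Then for every integer $n\ge\mu+1$ the one-sided limits and the Stieltjes integrals below exist, and $$\begin{aligned}\hat u_n=\frac{2n+1}2\Big\{&(I_{1-}^{\mu+1}P_n)(\theta)\,({}^C\!D_{\theta+}^\mu u)(\theta+)+\int_\theta^1(I_{1-}^{\mu+1}P_n)(x)\,d\{{}^C\!D_{\theta+}^\mu u(x)\}\\&+(I_{-1+}^{\mu+1}P_n)(\theta)\,({}^C\!D_{\theta-}^\mu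 u)(\theta-)-\int_{-1}^\theta(I_{-1+}^{\mu+1}P_n)(x)\,d\{{}^C\!D_{\theta-}^\mu u(x)\}\Big\}.\end{aligned}$$ Moreover $P_n^{(\mu+1,-\mu-1)}(1)\neq0$, and for all $x\in[-1,1]$ $$(I_{1-}^{\mu+1}P_n)(x)=\frac{(1-x)^{\mu+1}}{\Gamma(\mu+2)}\,\frac{P_n^{(\mu+1,-\mu-1)}(x)}{P_n^{(\mu+1,-\mu-1)}(1)},\qquad (I_{-1+}^{\mu+1}P_n)(x)=\frac{(1+x)^{\mu+1}}{\Gamma(\mu+2)}\,\frac{P_n^{(-\mu-1,\mu+1)}(x)}{P_n^{(\mu+1,-\mu-1)}(1)}.$$ -/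

import Mathlib

open Filter Topology MeasureTheory

noncomputable section

/-- The left-sided Riemann-Liouville fractional integral `I_{a+}^ρ f` of order `ρ ≥ 0`;
the integral of order `0` is the identity. -/
def leftRL (ρ a : ℝ) (f : ℝ → ℝ) (x : ℝ) : ℝ :=
  if ρ = 0 then f x
  else 1 / Real.Gamma ρ * ∫ y in a..x, f y * (x - y) ^ (ρ - 1)

/-- The right-sided Riemann-Liouville fractional integral `I_{b-}^ρ f` of order `ρ ≥ 0`;
the integral of order `0` is the identity. -/
def rightRL (ρ b : ℝ) (f : ℝ → ℝ) (x : ℝ) : ℝ :=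
  if ρ = 0 then f x
  else 1 / Real.Gamma ρ * ∫ y in x..b, f y * (y - x) ^ (ρ - 1)

/-- The left-sided Caputo derivative `I_{a+}^{k-μ} f^{(k)}` of order `μ ∈ (k-1, k]`. -/
def leftCaputo (k : ℕ) (μ a : ℝ) (f : ℝ → ℝ) : ℝ → ℝ :=
  leftRL (k - μ) a (iteratedDeriv k f)

/-- The right-sided Caputo derivative `(-1)^k I_{b-}^{k-μ} f^{(k)}` of order `μ ∈ (k-1, k]`. -/
def rightCaputo (k : ℕ) (μ b : ℝ) (f : ℝ → ℝ) (x : ℝ) : ℝ :=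
  (-1) ^ k * rightRL (k - μ) b (iteratedDeriv k f) x

/-- `J` is the Riemann-Stieltjes integral of `f` against `g` over `[a, b]`: the limit of the
tagged Riemann-Stieltjes sums as the mesh of the partition tends to zero. -/
def HasRSIntegral (f g : ℝ → ℝ) (a b J : ℝ) : Prop :=
  ∀ ε > 0, ∃ δ > 0, ∀ (m : ℕ) (x ξ : ℕ → ℝ), x 0 = a → x m = b →
    (∀ i < m, x i ≤ x (i + 1) ∧ x (i + 1) - x i < δ ∧ ξ i ∈ Set.Icc (x i) (x (i + 1))) →
      |∑ i ∈ Finset.range m, f (ξ i) * (g (x (i + 1)) - g (x i)) - J| < ε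

/-- `J` is the Stieltjes integral of `f` against `g` from `a` to `b` not counting any jump of
`g` at the end points: the values of `g` at `a` and at `b` are replaced by the one-sided
limits `g(a+)` and `g(b-)`, so that constant `f = 1` gives `g(b-) - g(a+)`. -/
def HasStieltjesIntegral (f g : ℝ → ℝ) (a b J : ℝ) : Prop :=
  ∃ ga gb : ℝ, Tendsto g (𝓝[>] a) (𝓝 ga) ∧ Tendsto g (𝓝[<] b) (𝓝 gb) ∧
    HasRSIntegral f (Function.update (Function.update g a ga) b gb) a b J

/-- The Legendre polynomial `P_n`, by Rodrigues' formula. -/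
def legendrePoly (n : ℕ) : Polynomial ℝ :=
  Polynomial.C (1 / (2 ^ n * (n.factorial : ℝ))) *
    Polynomial.derivative^[n] ((Polynomial.X ^ 2 - 1) ^ n)

/-- The Legendre polynomial `P_n` as a function on the line. -/
def legendreP (n : ℕ) (x : ℝ) : ℝ := (legendrePoly n).eval x

/-- The Legendre expansion coefficient of `u` of index `n`. -/
def legendreCoeff (u : ℝ → ℝ) (n : ℕ) : ℝ :=
  (2 * n + 1) / 2 * ∫ x in (-1 : ℝ)..1, u x * legendreP n x

/-- The generalised Jacobi polynomial `P_n^{(α,β)}` for arbitrary real `α, β`. This is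
`(α+1)_n / n! * ₂F₁(-n, n+α+β+1; α+1; (1-x)/2)` with the factor `(α+1)_n` multiplied into the
terminating hypergeometric sum, using `(α+1)_n / (α+1)_ν = (α+ν+1)_{n-ν}`; in this form it
also makes sense (as the continuous extension) when `α` is a negative integer. -/
def jacobiP (n : ℕ) (α β x : ℝ) : ℝ :=
  1 / (n.factorial : ℝ) * ∑ ν ∈ Finset.range (n + 1),
    (n.choose ν : ℝ) * (ascPochhammer ℝ ν).eval (n + α + β + 1) *
      (ascPochhammer ℝ (n - ν)).eval (α + ν + 1) * ((x - 1) / 2) ^ ν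

end

/-!
The argument is integration by parts: `k` times in the classical sense, then once fractionally, and
then once more in the Stieltjes sense.

All iterated and fractional integrals of `P_n` are known explicitly. Integrating the expansion of
`P_n` at `1` term by term with the beta integral gives `I_{1-}^ρ P_n = legendreFrac n ρ`
(`rightRL_legendreP`), and comparison of coefficients identifies it with
`(1-x)^ρ / Γ(ρ+1)` times a normalised Jacobi polynomial (`legendreFrac_eq_jacobiP`). The left-sided
integrals follow by the reflection `x ↦ -x`, using the parity of `P_n` and the symmetry
`P_n^{(α,β)}(-x) = (-1)^n P_n^{(β,α)}(x)` (`jacobiP_neg`), which is the Chu-Vandermonde identity.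
In this form the rule `(I_{1-}^{ρ+1} P_n)' = -I_{1-}^ρ P_n` (`hasDerivAt_legendreFrac`) and the
semigroup law (`rightRL_legendreFrac`) are immediate.

Split `∫ u P_n` at `θ`. On `[θ, 1]`, integrating by parts `k` times against `I_{1-}^j P_n`, which
vanishes at `1`, yields boundary terms `u^{(j)}(θ) (I_{1-}^{j+1} P_n)(θ)` with `j < k` and the
integral of `u^{(k)} I_{1-}^k P_n`. As `I_{1-}^k P_n = I_{1-}^{k-μ} I_{1-}^μ P_n`, Fubini's theorem
(`integral_mul_rightRL`) turns the latter into the integral of the Caputo derivative against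
`I_{1-}^μ P_n`. The interval `[-1, θ]` is treated in the same way, and the two families of boundary
terms cancel since `P_n` is orthogonal to `(x - θ)^j` for `j < n`
(`legendreFrac_add_reflect_eq_zero`).

Finally `I_{1-}^μ P_n` is minus the derivative of the continuously differentiable function
`I_{1-}^{μ+1} P_n`, so integration by parts against a function of bounded variation, which also
yields the existence of the Stieltjes integral (`hasRSIntegral_of_hasDerivAt`), gives the formula.
-/

/-! ### Jacobi and Legendre polynomials -/

theorem ascPochhammer_eval_eq_factorial_mul_choose (c : ℝ) (m : ℕ) :
    (ascPochhammer ℝ m).eval c = (m.factorial : ℝ) * Ring.choose (c + m - 1) m := by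
  have h := Ring.descPochhammer_eq_factorial_smul_choose (c + m - 1) m
  rw [Polynomial.descPochhammer_smeval_eq_ascPochhammer,
    Polynomial.ascPochhammer_smeval_eq_eval, nsmul_eq_mul] at h
  rw [← h]
  congr 1
  ring

theorem ascPochhammer_eval_natCast_add_one (m k : ℕ) :
    (ascPochhammer ℝ k).eval ((m : ℝ) + 1) = ((m + k).factorial : ℝ) / m.factorial := by
  have h : (ascPochhammer ℝ k).eval ((m : ℝ) + 1) = (((m + 1).ascFactorial k : ℕ) : ℝ) := by
    rw [← ascPochhammer_nat_eq_ascFactorial, ascPochhammer_eval_cast, Nat.cast_succ]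
  rw [h, eq_div_iff (by positivity), mul_comm]
  exact_mod_cast Nat.factorial_mul_ascFactorial m k

theorem jacobiP_eq_sum_choose (n : ℕ) (α β x : ℝ) :
    jacobiP n α β x = ∑ ν ∈ Finset.range (n + 1),
      Ring.choose (α + n) (n - ν) * Ring.choose (α + β + n + ν) ν * ((x - 1) / 2) ^ ν := by
  rw [jacobiP, Finset.mul_sum]
  refine Finset.sum_congr rfl fun ν hν => ?_
  have hle : ν ≤ n := Finset.mem_range_succ_iff.mp hν
  rw [ascPochhammer_eval_eq_factorial_mul_choose, ascPochhammer_eval_eq_factorial_mul_choose,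
    show (n : ℝ) + α + β + 1 + ν - 1 = α + β + n + ν by ring,
    show α + ν + 1 + ((n - ν : ℕ) : ℝ) - 1 = α + n by push_cast [hle]; ring]
  have h : (n.choose ν : ℝ) * ν.factorial * (n - ν).factorial = n.factorial := by
    exact_mod_cast Nat.choose_mul_factorial_mul_factorial hle
  rw [← h]
  have h0 : (n.choose ν : ℝ) ≠ 0 := by exact_mod_cast (Nat.choose_pos hle).ne'
  field_simp

/-- The expansion of a Jacobi polynomial in the products `((x-1)/2)^s ((x+1)/2)^(n-s)`, in which
the two parameters play symmetric roles. It follows from the expansion at `1` by the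
Chu-Vandermonde identity. -/
theorem jacobiP_eq_sum_symmetric (n : ℕ) (α β x : ℝ) :
    jacobiP n α β x = ∑ s ∈ Finset.range (n + 1),
      Ring.choose (α + n) (n - s) * Ring.choose (β + n) s *
        (((x - 1) / 2) ^ s * ((x + 1) / 2) ^ (n - s)) := by
  rw [jacobiP_eq_sum_choose]
  set z : ℝ := (x - 1) / 2 with hz
  have hexp : ∀ s ∈ Finset.range (n + 1), z ^ s * ((x + 1) / 2) ^ (n - s) =
      ∑ ν ∈ Finset.Ico s (n + 1), ((n - s).choose (ν - s) : ℝ) * z ^ ν := by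
    intro s hs
    have hle : s ≤ n := Finset.mem_range_succ_iff.mp hs
    rw [show (x + 1) / 2 = z + 1 by rw [hz]; ring, add_pow, Finset.sum_Ico_eq_sum_range,
      Finset.mul_sum, show n + 1 - s = n - s + 1 by lia]
    refine Finset.sum_congr rfl fun i _ => ?_
    rw [Nat.add_sub_cancel_left, one_pow, pow_add]
    ring
  have hcoef : ∀ ν ∈ Finset.range (n + 1),
      Ring.choose (α + n) (n - ν) * Ring.choose (α + β + n + ν) ν =
        ∑ s ∈ Finset.range (ν + 1), Ring.choose (α + n) (n - s) * Ring.choose (β + n) s *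
          ((n - s).choose (ν - s) : ℝ) := by
    intro ν hν
    have hle : ν ≤ n := Finset.mem_range_succ_iff.mp hν
    rw [show α + β + n + ν = (β + n) + (α + ν) by ring, Ring.add_choose_eq ν (Commute.all _ _),
      Finset.Nat.sum_antidiagonal_eq_sum_range_succ
        (fun i j => Ring.choose (β + n) i * Ring.choose (α + (ν : ℝ)) j), Finset.mul_sum]
    refine Finset.sum_congr rfl fun s hs => ?_
    have hs' : s ≤ ν := Finset.mem_range_succ_iff.mp hs
    have h := Ring.choose_smul_choose (α + n) (n := n - s) (k := n - ν) (by lia)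
    rw [nsmul_eq_mul, show n - s - (n - ν) = ν - s by lia,
      show (n - s).choose (n - ν) = (n - s).choose (ν - s) from
        Nat.choose_symm_of_eq_add (by lia),
      show α + n - ((n - ν : ℕ) : ℝ) = α + ν by push_cast [hle]; ring] at h
    linear_combination (-Ring.choose (β + (n : ℝ)) s) * h
  calc _ = ∑ ν ∈ Finset.range (n + 1), ∑ s ∈ Finset.range (ν + 1),
        Ring.choose (α + n) (n - s) * Ring.choose (β + n) s *
          (((n - s).choose (ν - s) : ℝ) * z ^ ν) := by
        refine Finset.sum_congr rfl fun ν hν => ?_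
        rw [hcoef ν hν, Finset.sum_mul]
        exact Finset.sum_congr rfl fun s _ => by ring
    _ = ∑ s ∈ Finset.range (n + 1), ∑ ν ∈ Finset.Ico s (n + 1),
        Ring.choose (α + n) (n - s) * Ring.choose (β + n) s *
          (((n - s).choose (ν - s) : ℝ) * z ^ ν) := by
        refine Finset.sum_comm' fun ν s => ?_
        simp only [Finset.mem_range, Finset.mem_Ico]
        lia
    _ = _ := by
        refine Finset.sum_congr rfl fun s hs => ?_
        rw [hexp s hs, Finset.mul_sum]

theorem jacobiP_neg (n : ℕ) (α β x : ℝ) : jacobiP n α β (-x) = (-1) ^ n * jacobiP n β α x := by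
  rw [jacobiP_eq_sum_symmetric, jacobiP_eq_sum_symmetric, ← Finset.sum_range_reflect,
    Finset.mul_sum]
  refine Finset.sum_congr rfl fun s hs => ?_
  have hle : s ≤ n := Finset.mem_range_succ_iff.mp hs
  rw [show n + 1 - 1 - s = n - s by lia, show n - (n - s) = s by lia,
    show (-x - 1) / 2 = -((x + 1) / 2) by ring, show (-x + 1) / 2 = -((x - 1) / 2) by ring,
    neg_pow ((x + 1) / 2), neg_pow ((x - 1) / 2), ← Nat.sub_add_cancel hle, pow_add (-1 : ℝ)]
  simp only [Nat.add_sub_cancel]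
  ring

/-- Rodrigues' formula, expanded at `1`: the Legendre polynomial is the Jacobi polynomial with
parameters `0, 0`. -/
theorem legendreP_eq_jacobiP (n : ℕ) (x : ℝ) : legendreP n x = jacobiP n 0 0 x := by
  have hw : ((Polynomial.X : Polynomial ℝ) ^ 2 - 1) ^ n = ∑ j ∈ Finset.range (n + 1),
      Polynomial.C ((n.choose j : ℝ) * 2 ^ (n - j)) *
        (Polynomial.X - Polynomial.C 1) ^ (n + j) := by
    rw [show (Polynomial.X : Polynomial ℝ) ^ 2 - 1 = (Polynomial.X - Polynomial.C 1) *
      ((Polynomial.X - Polynomial.C 1) + Polynomial.C 2) by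
        rw [show (Polynomial.C (2 : ℝ)) = 2 from rfl, Polynomial.C_1]; ring,
      mul_pow, add_pow, Finset.mul_sum]
    refine Finset.sum_congr rfl fun j _ => ?_
    rw [Polynomial.C_mul, Polynomial.C_pow, Polynomial.C_eq_natCast, pow_add]
    ring
  rw [legendreP, legendrePoly, hw, Polynomial.iterate_derivative_sum, Polynomial.eval_mul,
    Polynomial.eval_C, Polynomial.eval_finsetSum, jacobiP, Finset.mul_sum, Finset.mul_sum]
  refine Finset.sum_congr rfl fun j hj => ?_
  have hle : j ≤ n := Finset.mem_range_succ_iff.mp hj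
  rw [Polynomial.iterate_derivative_C_mul, Polynomial.iterate_derivative_X_sub_pow,
    Nat.add_sub_cancel_left]
  have h1 : ((n + j).descFactorial n : ℝ) = ((n + j).factorial : ℝ) / j.factorial := by
    rw [eq_div_iff (by positivity), mul_comm]
    have := Nat.factorial_mul_descFactorial (Nat.le_add_right n j)
    rw [Nat.add_sub_cancel_left] at this
    exact_mod_cast this
  have h2 : (2 : ℝ) ^ n = 2 ^ (n - j) * 2 ^ j := by rw [← pow_add, Nat.sub_add_cancel hle]
  simp only [nsmul_eq_mul, Polynomial.eval_mul, Polynomial.eval_C, Polynomial.eval_natCast,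
    Polynomial.eval_pow, Polynomial.eval_sub, Polynomial.eval_X, add_zero, zero_add]
  rw [ascPochhammer_eval_natCast_add_one, ascPochhammer_eval_natCast_add_one, h1,
    Nat.add_sub_cancel' hle, h2, div_pow]
  field_simp

theorem legendreP_neg (n : ℕ) (x : ℝ) : legendreP n (-x) = (-1) ^ n * legendreP n x := by
  rw [legendreP_eq_jacobiP, legendreP_eq_jacobiP, jacobiP_neg]

theorem continuous_legendreP (n : ℕ) : Continuous (legendreP n) :=
  (legendrePoly n).continuous

/-- The derivatives of `(X²-1)^n` of order `m ≤ n` are orthogonal on `[-1,1]` to the polynomials of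
degree less than `m`: each integration by parts lowers the order by one, the boundary terms
vanishing because `±1` are zeros of order `n`. -/
theorem integral_iterate_derivative_mul_eq_zero (n m : ℕ) (hm : m ≤ n) :
    ∀ p : Polynomial ℝ, p.degree < m →
      ∫ x in (-1 : ℝ)..1,
        p.eval x * (Polynomial.derivative^[m] ((Polynomial.X ^ 2 - 1) ^ n)).eval x = 0 := by
  induction m with
  | zero =>
    intro p hp
    have : p = 0 := Polynomial.degree_eq_bot.mp (by simpa using hp)
    simp [this]
  | succ m ih =>
    intro p hp
    set W : Polynomial ℝ := Polynomial.derivative^[m] ((Polynomial.X ^ 2 - 1) ^ n) with hW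
    have hdvd : (Polynomial.X ^ 2 - 1 : Polynomial ℝ) ∣ W :=
      (dvd_pow_self _ (by lia : n - m ≠ 0)).trans
        (Polynomial.pow_sub_dvd_iterate_derivative_pow _ n m)
    have h1 : W.eval 1 = 0 := by
      obtain ⟨r, hr⟩ := hdvd
      simp [hr]
    have h2 : W.eval (-1) = 0 := by
      obtain ⟨r, hr⟩ := hdvd
      simp [hr]
    have hp' : p.derivative.degree < m := by
      rcases eq_or_ne p 0 with rfl | h0
      · simp
      · have := Polynomial.degree_derivative_lt h0
        rcases eq_or_ne p.derivative 0 with h0' | h0'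
        · simp [h0']
        · rw [Polynomial.degree_eq_natDegree h0] at hp this
          rw [Polynomial.degree_eq_natDegree h0'] at this ⊢
          norm_cast at hp this ⊢
          lia
    rw [Function.iterate_succ_apply', intervalIntegral.integral_mul_deriv_eq_deriv_mul
      (fun x _ => p.hasDerivAt x) (fun x _ => W.hasDerivAt x)
      (p.derivative.continuous.intervalIntegrable _ _)
      (W.derivative.continuous.intervalIntegrable _ _), h1, h2, ih (by lia) _ hp']
    simp

theorem integral_mul_legendreP_eq_zero (n : ℕ) (p : Polynomial ℝ) (hp : p.degree < n) :
    ∫ x in (-1 : ℝ)..1, p.eval x * legendreP n x = 0 := by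
  have h := integral_iterate_derivative_mul_eq_zero n n le_rfl p hp
  simp only [legendreP, legendrePoly, Polynomial.eval_mul, Polynomial.eval_C]
  rw [← mul_zero (1 / (2 ^ n * (n.factorial : ℝ))), ← h, ← intervalIntegral.integral_const_mul]
  exact intervalIntegral.integral_congr fun x _ => by ring

/-! ### Fractional integrals of the Legendre polynomials -/

/-- The beta integral over `[0, a]`, for real exponents. -/
theorem integral_rpow_mul_sub_rpow {ρ σ a : ℝ} (hρ : 0 < ρ) (hσ : 0 < σ) (ha : 0 < a) :
    ∫ t in (0 : ℝ)..a, t ^ (ρ - 1) * (a - t) ^ (σ - 1) =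
      a ^ (ρ + σ - 1) * (Real.Gamma ρ * Real.Gamma σ / Real.Gamma (ρ + σ)) := by
  have h := Complex.betaIntegral_scaled (ρ : ℂ) (σ : ℂ) ha
  rw [Complex.betaIntegral_eq_Gamma_mul_div _ _ (by simpa) (by simpa), ← Complex.ofReal_add,
    Complex.Gamma_ofReal, Complex.Gamma_ofReal, Complex.Gamma_ofReal,
    intervalIntegral.integral_congr
      (g := fun t : ℝ => ((t ^ (ρ - 1) * (a - t) ^ (σ - 1) : ℝ) : ℂ)),
    intervalIntegral.integral_ofReal] at h
  · rw [show ((ρ + σ : ℝ) : ℂ) - 1 = ((ρ + σ - 1 : ℝ) : ℂ) by push_cast; ring,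
      ← Complex.ofReal_cpow ha.le] at h
    exact_mod_cast h
  · intro t ht
    rw [Set.uIcc_of_le ha.le] at ht
    simp only
    rw [Complex.ofReal_mul, Complex.ofReal_cpow ht.1, Complex.ofReal_cpow (sub_nonneg.mpr ht.2)]
    push_cast
    rfl

theorem intervalIntegrable_sub_rpow {ρ : ℝ} (hρ : 0 < ρ) (x a b : ℝ) :
    IntervalIntegrable (fun y => (y - x) ^ (ρ - 1)) volume a b := by
  have h := (intervalIntegral.intervalIntegrable_rpow' (a := a - x) (b := b - x)
    (r := ρ - 1) (by linarith)).comp_sub_right x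
  simpa using h

/-- The fractional integral of order `ρ` of the power `(1 - y)^σ`. -/
theorem rightRL_one_sub_rpow {ρ σ x : ℝ} (hρ : 0 < ρ) (hσ : 0 ≤ σ) (hx : x ≤ 1) :
    1 / Real.Gamma ρ * ∫ y in x..1, (1 - y) ^ σ * (y - x) ^ (ρ - 1) =
      Real.Gamma (σ + 1) / Real.Gamma (σ + ρ + 1) * (1 - x) ^ (σ + ρ) := by
  rcases hx.eq_or_lt with rfl | hx
  · rw [intervalIntegral.integral_same, sub_self, Real.zero_rpow (by linarith)]
    simp
  · have h := integral_rpow_mul_sub_rpow hρ (by linarith : 0 < σ + 1) (sub_pos.mpr hx)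
    have hs := intervalIntegral.integral_comp_sub_right (a := x) (b := 1)
      (fun t => t ^ (ρ - 1) * (1 - x - t) ^ σ) x
    rw [show σ + 1 - 1 = σ by ring, show ρ + (σ + 1) - 1 = σ + ρ by ring,
      show ρ + (σ + 1) = σ + ρ + 1 by ring] at h
    rw [sub_self, h] at hs
    rw [intervalIntegral.integral_congr
      (g := fun y => (y - x) ^ (ρ - 1) * (1 - x - (y - x)) ^ σ), hs]
    · have := (Real.Gamma_pos_of_pos hρ).ne'
      field_simp
    · intro y _
      simp only
      rw [show 1 - x - (y - x) = 1 - y by ring, mul_comm]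

/-- The fractional integral `I_{1-}^ρ P_n` of the Legendre polynomial, obtained by integrating
the expansion of `P_n` at `1` term by term. It is defined on the whole line, although it equals
the fractional integral only on `(-∞, 1]`. -/
noncomputable def legendreFrac (n : ℕ) (ρ x : ℝ) : ℝ :=
  ∑ ν ∈ Finset.range (n + 1),
    (n.choose ν : ℝ) * (((n + ν).factorial : ℝ) / n.factorial) * (-1 / 2) ^ ν
      / Real.Gamma (ν + ρ + 1) * (1 - x) ^ ((ν : ℝ) + ρ)

theorem legendreFrac_zero (n : ℕ) (x : ℝ) : legendreFrac n 0 x = legendreP n x := by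
  rw [legendreP_eq_jacobiP, jacobiP, legendreFrac, Finset.mul_sum]
  refine Finset.sum_congr rfl fun ν hν => ?_
  have hle : ν ≤ n := Finset.mem_range_succ_iff.mp hν
  simp only [add_zero, zero_add]
  rw [ascPochhammer_eval_natCast_add_one, ascPochhammer_eval_natCast_add_one,
    Nat.add_sub_cancel' hle, Real.rpow_natCast, Real.Gamma_nat_eq_factorial,
    show (x - 1) / 2 = (-1 / 2) * (1 - x) by ring, mul_pow]
  field_simp

theorem continuous_legendreFrac (n : ℕ) {ρ : ℝ} (hρ : 0 ≤ ρ) : Continuous (legendreFrac n ρ) := by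
  unfold legendreFrac
  refine continuous_finsetSum _ fun ν _ => continuous_const.mul ?_
  exact (Real.continuous_rpow_const (by positivity)).comp (continuous_const.sub continuous_id)

theorem hasDerivAt_legendreFrac (n : ℕ) {ρ : ℝ} (hρ : 0 ≤ ρ) (x : ℝ) :
    HasDerivAt (legendreFrac n (ρ + 1)) (-legendreFrac n ρ x) x := by
  unfold legendreFrac
  rw [← Finset.sum_neg_distrib]
  refine HasDerivAt.fun_sum fun ν _ => ?_
  have h0 : (0 : ℝ) ≤ ν + ρ := by positivity
  have h1 : HasDerivAt (fun x : ℝ => (1 - x) ^ ((ν : ℝ) + (ρ + 1)))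
      (-1 * ((ν : ℝ) + (ρ + 1)) * (1 - x) ^ ((ν : ℝ) + (ρ + 1) - 1)) x :=
    ((hasDerivAt_id x).const_sub 1).rpow_const (Or.inr (by linarith))
  refine (h1.const_mul _).congr_deriv ?_
  rw [show (ν : ℝ) + (ρ + 1) - 1 = ν + ρ by ring,
    show (ν : ℝ) + (ρ + 1) + 1 = (ν + ρ + 1) + 1 by ring,
    Real.Gamma_add_one (by positivity), show (ν : ℝ) + (ρ + 1) = ν + ρ + 1 by ring]
  have := (Real.Gamma_pos_of_pos (by positivity : 0 < (ν : ℝ) + ρ + 1)).ne'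
  field_simp

theorem legendreFrac_one (n : ℕ) {ρ : ℝ} (hρ : 0 < ρ) : legendreFrac n ρ 1 = 0 := by
  refine Finset.sum_eq_zero fun ν _ => ?_
  rw [sub_self, Real.zero_rpow (by positivity), mul_zero]

theorem absolutelyContinuousOnInterval_of_hasDerivAt {F h : ℝ → ℝ}
    (hF : ∀ x, HasDerivAt F (h x) x) (hh : Continuous h) (a b : ℝ) :
    AbsolutelyContinuousOnInterval F a b := by
  refine ContDiffOn.absolutelyContinuousOnInterval (ContDiff.contDiffOn ?_)
  rw [contDiff_one_iff_deriv]
  refine ⟨fun x => (hF x).differentiableAt, ?_⟩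
  rwa [show deriv F = h from funext fun x => (hF x).deriv]

theorem hasDerivAt_neg_one_pow_mul_legendreFrac_neg (n : ℕ) {ρ : ℝ} (hρ : 0 ≤ ρ) (x : ℝ) :
    HasDerivAt (fun x => (-1) ^ n * legendreFrac n (ρ + 1) (-x))
      ((-1) ^ n * legendreFrac n ρ (-x)) x := by
  refine (((hasDerivAt_legendreFrac n hρ (-x)).comp x
    (hasDerivAt_neg x)).const_mul _).congr_deriv ?_
  ring

theorem continuous_neg_one_pow_mul_legendreFrac_neg (n : ℕ) {ρ : ℝ} (hρ : 0 ≤ ρ) :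
    Continuous fun x => (-1) ^ n * legendreFrac n ρ (-x) :=
  continuous_const.mul ((continuous_legendreFrac n hρ).comp continuous_neg)

/-- The semigroup property of the fractional integrals, on the Legendre polynomials. -/
theorem rightRL_legendreFrac (n : ℕ) {ρ σ x : ℝ} (hρ : 0 ≤ ρ) (hσ : 0 ≤ σ) (hx : x ≤ 1) :
    rightRL ρ 1 (legendreFrac n σ) x = legendreFrac n (σ + ρ) x := by
  rcases hρ.eq_or_lt with rfl | hρ
  · simp [rightRL]
  · rw [rightRL, if_neg hρ.ne']
    unfold legendreFrac
    simp only [Finset.sum_mul, mul_assoc]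
    rw [intervalIntegral.integral_finsetSum]
    · rw [Finset.mul_sum]
      refine Finset.sum_congr rfl fun ν _ => ?_
      have h := rightRL_one_sub_rpow hρ (by positivity : 0 ≤ (ν : ℝ) + σ) hx
      have := (Real.Gamma_pos_of_pos (by positivity : 0 < (ν : ℝ) + σ + 1)).ne'
      rw [intervalIntegral.integral_const_mul, mul_left_comm, h, ← add_assoc]
      field_simp
    · intro ν _
      refine ((intervalIntegrable_sub_rpow hρ x x 1).continuousOn_mul ?_).const_mul _
      refine ((Real.continuous_rpow_const (by positivity)).comp
        (continuous_const.sub continuous_id)).continuousOn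

theorem rightRL_legendreP (n : ℕ) {ρ x : ℝ} (hρ : 0 ≤ ρ) (hx : x ≤ 1) :
    rightRL ρ 1 (legendreP n) x = legendreFrac n ρ x := by
  rw [← show legendreFrac n 0 = legendreP n from funext (legendreFrac_zero n),
    rightRL_legendreFrac n hρ le_rfl hx, zero_add]

theorem leftRL_eq_rightRL_comp_neg (ρ a : ℝ) (f : ℝ → ℝ) (x : ℝ) :
    leftRL ρ a f x = rightRL ρ (-a) (fun y => f (-y)) (-x) := by
  rw [leftRL, rightRL, neg_neg]
  congr 2
  rw [← intervalIntegral.integral_comp_neg]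
  refine intervalIntegral.integral_congr fun y _ => ?_
  rw [neg_neg, show -y - -x = x - y by ring]

theorem rightRL_const_mul (ρ b c : ℝ) (f : ℝ → ℝ) (x : ℝ) :
    rightRL ρ b (fun y => c * f y) x = c * rightRL ρ b f x := by
  unfold rightRL
  split_ifs
  · rfl
  · simp only [mul_assoc, intervalIntegral.integral_const_mul]
    ring

theorem leftRL_legendreP (n : ℕ) {ρ x : ℝ} (hρ : 0 ≤ ρ) (hx : -1 ≤ x) :
    leftRL ρ (-1) (legendreP n) x = (-1) ^ n * legendreFrac n ρ (-x) := by
  rw [leftRL_eq_rightRL_comp_neg, neg_neg]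
  simp only [legendreP_neg]
  rw [rightRL_const_mul, rightRL_legendreP n hρ (by linarith)]

theorem Gamma_mul_ascPochhammer_eval {c : ℝ} (hc : 0 < c) (m : ℕ) :
    Real.Gamma c * (ascPochhammer ℝ m).eval c = Real.Gamma (c + m) := by
  induction m with
  | zero => simp
  | succ m ih =>
    rw [ascPochhammer_succ_eval, ← mul_assoc, ih, Nat.cast_succ, ← add_assoc,
      Real.Gamma_add_one (by positivity), mul_comm]

theorem jacobiP_one (n : ℕ) (α β : ℝ) :
    jacobiP n α β 1 = (ascPochhammer ℝ n).eval (α + 1) / n.factorial := by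
  rw [jacobiP, Finset.sum_range_succ', Finset.sum_eq_zero]
  · simp
    ring
  · intro ν _
    simp

theorem jacobiP_one_pos (n : ℕ) {α : ℝ} (hα : -1 < α) (β : ℝ) : 0 < jacobiP n α β 1 := by
  rw [jacobiP_one]
  exact div_pos (ascPochhammer_pos n _ (by linarith)) (by positivity)

/-- The fractional integrals of `P_n` in terms of Jacobi polynomials. -/
theorem legendreFrac_eq_jacobiP (n : ℕ) {ρ x : ℝ} (hρ : 0 ≤ ρ) (hx : x ≤ 1) :
    legendreFrac n ρ x =
      (1 - x) ^ ρ / Real.Gamma (ρ + 1) * (jacobiP n ρ (-ρ) x / jacobiP n ρ (-ρ) 1) := by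
  rw [jacobiP_one, jacobiP, legendreFrac, Finset.mul_sum, Finset.sum_div, Finset.mul_sum]
  refine Finset.sum_congr rfl fun ν hν => ?_
  have hle : ν ≤ n := Finset.mem_range_succ_iff.mp hν
  rw [show (n : ℝ) + ρ + -ρ + 1 = n + 1 by ring, ascPochhammer_eval_natCast_add_one,
    Real.rpow_add_of_nonneg (by linarith) (by positivity) hρ, Real.rpow_natCast,
    show (x - 1) / 2 = (-1 / 2) * (1 - x) by ring, mul_pow]
  have h1 := Gamma_mul_ascPochhammer_eval (by linarith : 0 < ρ + 1) n
  have h2 := Gamma_mul_ascPochhammer_eval (by positivity : 0 < ρ + ν + 1) (n - ν)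
  rw [show ρ + ν + 1 + ((n - ν : ℕ) : ℝ) = ρ + 1 + n by push_cast [hle]; ring, ← h1] at h2
  have p0 := (Real.Gamma_pos_of_pos (by linarith : 0 < ρ + 1)).ne'
  have p1 := (Real.Gamma_pos_of_pos (by positivity : 0 < ρ + ν + 1)).ne'
  have p2 := (ascPochhammer_pos n (ρ + 1) (by linarith)).ne'
  rw [show (ν : ℝ) + ρ + 1 = ρ + ν + 1 by ring]
  field_simp
  linear_combination (-((n.choose ν : ℝ) * (1 - x) ^ ρ * (1 - x) ^ ν)) * h2

/-! ### Riemann-Stieltjes integration by parts -/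

theorem BoundedVariationOn.intervalIntegrable {g : ℝ → ℝ} {a b : ℝ}
    (hg : BoundedVariationOn g (Set.uIcc a b)) : IntervalIntegrable g volume a b := by
  obtain ⟨p, q, hp, hq, rfl⟩ := hg.locallyBoundedVariationOn.exists_monotoneOn_sub_monotoneOn
  exact hp.intervalIntegrable.sub hq.intervalIntegrable

/-- Changing a function of bounded variation at both end points leaves its increments dominated by
those of some function `V`, namely its variation function shifted at the two end points. -/
theorem BoundedVariationOn.exists_abs_sub_le_update {g : ℝ → ℝ} {a b : ℝ} (hab : a < b)
    (hg : BoundedVariationOn g (Set.Icc a b)) (ga gb : ℝ) :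
    ∃ V : ℝ → ℝ, ∀ x ∈ Set.Icc a b, ∀ y ∈ Set.Icc a b, x ≤ y →
      |Function.update (Function.update g a ga) b gb y
        - Function.update (Function.update g a ga) b gb x| ≤ V y - V x := by
  set W : ℝ → ℝ := variationOnFromTo g (Set.Icc a b) a
  have hW : ∀ x ∈ Set.Icc a b, ∀ y ∈ Set.Icc a b, x ≤ y → |g y - g x| ≤ W y - W x :=
    fun x hx y hy hxy => variationOnFromTo.abs_sub_le_sub_of_le hg.locallyBoundedVariationOn
      (Set.left_mem_Icc.mpr hab.le) hx hy hxy
  refine ⟨fun x => W x + (if x = b then |gb - g b| else 0) - (if x = a then |ga - g a| else 0),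
    fun x hx y hy hxy => ?_⟩
  have h := hW x hx y hy hxy
  have ha := abs_nonneg (ga - g a)
  have hb := abs_nonneg (gb - g b)
  simp only [Function.update_apply]
  rw [abs_le] at h ⊢
  have ha1 := neg_abs_le (ga - g a)
  have ha2 := le_abs_self (ga - g a)
  have hb1 := neg_abs_le (gb - g b)
  have hb2 := le_abs_self (gb - g b)
  obtain ⟨hx1, hx2⟩ := hx
  obtain ⟨hy1, hy2⟩ := hy
  split_ifs <;> subst_vars <;> first | (constructor <;> linarith) | (exfalso; order)

/-- The difference between one term of a Riemann-Stieltjes sum and the corresponding term of the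
formula of integration by parts is `∫ h (g - g x₀) + ∫ h (g - g x₁)`, over the two pieces into which
the tag `ξ` divides the interval. -/
theorem abs_stieltjes_term_sub_le {F h g : ℝ → ℝ} {x₀ ξ x₁ C D : ℝ}
    (hF : ∀ x, HasDerivAt F (h x) x) (hh : Continuous h) (hg : IntervalIntegrable g volume x₀ x₁)
    (h0 : x₀ ≤ ξ) (h1 : ξ ≤ x₁) (hC : ∀ x ∈ Set.Icc x₀ x₁, |h x| ≤ C)
    (hD0 : ∀ x ∈ Set.Icc x₀ x₁, |g x - g x₀| ≤ D) (hD1 : ∀ x ∈ Set.Icc x₀ x₁, |g x - g x₁| ≤ D) :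
    |F ξ * (g x₁ - g x₀) - (F x₁ * g x₁ - F x₀ * g x₀ - ∫ x in x₀..x₁, h x * g x)| ≤
      C * D * (x₁ - x₀) := by
  have hi : ∀ a b, IntervalIntegrable h volume a b := fun a b => hh.intervalIntegrable a b
  have hFTC : ∀ a b, ∫ x in a..b, h x = F b - F a := fun a b =>
    intervalIntegral.integral_eq_sub_of_hasDerivAt (fun x _ => hF x) (hi a b)
  have hg0 : IntervalIntegrable (fun x => h x * g x) volume x₀ ξ :=
    (hg.mono_set (Set.uIcc_subset_uIcc_left (by rw [Set.uIcc_of_le (h0.trans h1)]; exact ⟨h0, h1⟩))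
      ).continuousOn_mul hh.continuousOn
  have hg1 : IntervalIntegrable (fun x => h x * g x) volume ξ x₁ :=
    (hg.mono_set (Set.uIcc_subset_uIcc_right (by rw [Set.uIcc_of_le (h0.trans h1)]; exact ⟨h0, h1⟩))
      ).continuousOn_mul hh.continuousOn
  have e0 : ∫ x in x₀..ξ, h x * (g x - g x₀) =
      (∫ x in x₀..ξ, h x * g x) - (F ξ - F x₀) * g x₀ := by
    simp only [mul_sub]
    rw [intervalIntegral.integral_sub hg0 ((hi _ _).mul_const _),
      intervalIntegral.integral_mul_const, hFTC]
  have e1 : ∫ x in ξ..x₁, h x * (g x - g x₁) =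
      (∫ x in ξ..x₁, h x * g x) - (F x₁ - F ξ) * g x₁ := by
    simp only [mul_sub]
    rw [intervalIntegral.integral_sub hg1 ((hi _ _).mul_const _),
      intervalIntegral.integral_mul_const, hFTC]
  have b0 := intervalIntegral.norm_integral_le_of_norm_le_const
    (f := fun x => h x * (g x - g x₀)) (a := x₀) (b := ξ) (C := C * D) (by
      intro x hx
      rw [Set.uIoc_of_le h0] at hx
      have hx' : x ∈ Set.Icc x₀ x₁ := ⟨hx.1.le, hx.2.trans h1⟩
      rw [norm_mul]
      exact mul_le_mul (hC x hx') (hD0 x hx') (abs_nonneg _) ((abs_nonneg _).trans (hC x hx')))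
  have b1 := intervalIntegral.norm_integral_le_of_norm_le_const
    (f := fun x => h x * (g x - g x₁)) (a := ξ) (b := x₁) (C := C * D) (by
      intro x hx
      rw [Set.uIoc_of_le h1] at hx
      have hx' : x ∈ Set.Icc x₀ x₁ := ⟨h0.trans hx.1.le, hx.2⟩
      rw [norm_mul]
      exact mul_le_mul (hC x hx') (hD1 x hx') (abs_nonneg _) ((abs_nonneg _).trans (hC x hx')))
  rw [abs_of_nonneg (by linarith), Real.norm_eq_abs] at b0 b1
  rw [← intervalIntegral.integral_add_adjacent_intervals hg0 hg1]
  rw [show F ξ * (g x₁ - g x₀) - (F x₁ * g x₁ - F x₀ * g x₀ -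
      ((∫ x in x₀..ξ, h x * g x) + ∫ x in ξ..x₁, h x * g x)) =
      (∫ x in x₀..ξ, h x * (g x - g x₀)) + ∫ x in ξ..x₁, h x * (g x - g x₁) by
    rw [e0, e1]; ring]
  refine (abs_add_le _ _).trans ((add_le_add b0 b1).trans_eq ?_)
  ring

/-- Integration by parts for the Riemann-Stieltjes integral of a continuously differentiable
function against a function of bounded variation; the existence of the integral is part of the
conclusion. The bounded variation enters through a function `V` dominating the increments. -/
theorem hasRSIntegral_of_hasDerivAt {f F h g V : ℝ → ℝ} {a b : ℝ} (hab : a ≤ b)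
    (hfF : ∀ x ∈ Set.Icc a b, f x = F x) (hF : ∀ x, HasDerivAt F (h x) x) (hh : Continuous h)
    (hg : IntervalIntegrable g volume a b)
    (hV : ∀ x ∈ Set.Icc a b, ∀ y ∈ Set.Icc a b, x ≤ y → |g y - g x| ≤ V y - V x) :
    HasRSIntegral f g a b (f b * g b - f a * g a - ∫ x in a..b, h x * g x) := by
  obtain ⟨C, hC⟩ := isCompact_Icc.exists_bound_of_continuousOn (hh.continuousOn (s := Set.Icc a b))
  have haI : a ∈ Set.Icc a b := Set.left_mem_Icc.mpr hab
  have hbI : b ∈ Set.Icc a b := Set.right_mem_Icc.mpr hab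
  have hC0 : 0 ≤ C := (norm_nonneg _).trans (hC a haI)
  have hVab : 0 ≤ V b - V a := (abs_nonneg _).trans (hV a haI b hbI hab)
  have hpos : 0 < C * (V b - V a) + 1 := by positivity
  intro ε hε
  refine ⟨ε / (C * (V b - V a) + 1), by positivity, fun m x ξ hx0 hxm hp => ?_⟩
  set δ := ε / (C * (V b - V a) + 1) with hδ
  have hδ0 : 0 < δ := by positivity
  have hlow : ∀ i ≤ m, a ≤ x i := by
    intro i
    induction i with
    | zero => exact fun _ => hx0.ge
    | succ i ih => exact fun hi => (ih (by lia)).trans (hp i (by lia)).1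
  have hhigh : ∀ i ≤ m, x (m - i) ≤ b := by
    intro i
    induction i with
    | zero => exact fun _ => hxm.le
    | succ i ih =>
      intro hi
      have := (hp (m - (i + 1)) (by lia)).1
      rw [show m - (i + 1) + 1 = m - i by lia] at this
      exact this.trans (ih (by lia))
  have hmem : ∀ i ≤ m, x i ∈ Set.Icc a b := fun i hi => by
    refine ⟨hlow i hi, ?_⟩
    have := hhigh (m - i) (by lia)
    rwa [show m - (m - i) = i by lia] at this
  have hgi : ∀ i < m, IntervalIntegrable g volume (x i) (x (i + 1)) := fun i hi => by
    refine hg.mono_set (Set.uIcc_subset_uIcc ?_ ?_)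
    · rw [Set.uIcc_of_le hab]; exact hmem i hi.le
    · rw [Set.uIcc_of_le hab]; exact hmem (i + 1) hi
  have hJ : f b * g b - f a * g a - ∫ x in a..b, h x * g x =
      ∑ i ∈ Finset.range m, (F (x (i + 1)) * g (x (i + 1)) - F (x i) * g (x i)
        - ∫ t in x i..x (i + 1), h t * g t) := by
    rw [Finset.sum_sub_distrib, Finset.sum_range_sub (fun i => F (x i) * g (x i)),
      intervalIntegral.sum_integral_adjacent_intervals
        (fun i hi => (hgi i hi).continuousOn_mul hh.continuousOn), hx0, hxm, hfF a haI, hfF b hbI]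
  have hsub : ∀ i < m, Set.Icc (x i) (x (i + 1)) ⊆ Set.Icc a b := fun i hi =>
    Set.Icc_subset_Icc (hmem i hi.le).1 (hmem (i + 1) hi).2
  rw [hJ, ← Finset.sum_sub_distrib]
  have hterm : ∀ i ∈ Finset.range m,
      |f (ξ i) * (g (x (i + 1)) - g (x i)) - (F (x (i + 1)) * g (x (i + 1)) - F (x i) * g (x i)
        - ∫ t in x i..x (i + 1), h t * g t)| ≤ C * δ * (V (x (i + 1)) - V (x i)) := by
    intro i hi
    have hi := Finset.mem_range.mp hi
    obtain ⟨hle, hlt, hξ⟩ := hp i hi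
    have mi := hmem i hi.le
    have mi' := hmem (i + 1) hi
    rw [hfF _ (hsub i hi hξ)]
    refine (abs_stieltjes_term_sub_le (C := C) (D := V (x (i + 1)) - V (x i)) hF hh (hgi i hi)
      hξ.1 hξ.2 (fun t ht => hC t (hsub i hi ht)) (fun t ht => ?_) (fun t ht => ?_)).trans ?_
    · have e1 := hV _ mi _ (hsub i hi ht) ht.1
      have e2 := (abs_nonneg _).trans (hV _ (hsub i hi ht) _ mi' ht.2)
      linarith
    · have e1 := hV _ (hsub i hi ht) _ mi' ht.2
      have e2 := (abs_nonneg _).trans (hV _ mi _ (hsub i hi ht) ht.1)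
      rw [abs_sub_comm]
      linarith
    · have hD : 0 ≤ V (x (i + 1)) - V (x i) := (abs_nonneg _).trans (hV _ mi _ mi' hle)
      calc _ ≤ C * (V (x (i + 1)) - V (x i)) * δ := by gcongr
        _ = _ := by ring
  calc _ ≤ ∑ i ∈ Finset.range m, C * δ * (V (x (i + 1)) - V (x i)) :=
        (Finset.abs_sum_le_sum_abs _ _).trans (Finset.sum_le_sum hterm)
    _ = δ * (C * (V b - V a)) := by
        rw [← Finset.mul_sum, Finset.sum_range_sub (fun i => V (x i)), hx0, hxm]
        ring
    _ < δ * (C * (V b - V a) + 1) := by gcongr; linarith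
    _ = ε := by rw [hδ]; field_simp

/-- Integration by parts for the Stieltjes integral that does not count jumps at the end points. -/
theorem BoundedVariationOn.hasStieltjesIntegral {f F h g : ℝ → ℝ} {a b ga gb : ℝ} (hab : a < b)
    (hg : BoundedVariationOn g (Set.Icc a b)) (hga : Tendsto g (𝓝[>] a) (𝓝 ga))
    (hgb : Tendsto g (𝓝[<] b) (𝓝 gb)) (hfF : ∀ x ∈ Set.Icc a b, f x = F x)
    (hF : ∀ x, HasDerivAt F (h x) x) (hh : Continuous h) :
    HasStieltjesIntegral f g a b (f b * gb - f a * ga - ∫ x in a..b, h x * g x) := by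
  refine ⟨ga, gb, hga, hgb, ?_⟩
  obtain ⟨V, hV⟩ := hg.exists_abs_sub_le_update hab ga gb
  set g' := Function.update (Function.update g a ga) b gb with hg'
  have hae : ∀ᵐ x, g' x = g x := by
    have : (({a, b} : Set ℝ)ᶜ) ∈ ae volume :=
      compl_mem_ae_iff.mpr (Set.Finite.measure_zero (Set.toFinite _) _)
    filter_upwards [this] with x hx
    simp only [Set.mem_compl_iff, Set.mem_insert_iff, Set.mem_singleton_iff, not_or] at hx
    rw [hg', Function.update_of_ne hx.2, Function.update_of_ne hx.1]
  have hgi : IntervalIntegrable g volume a b :=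
    BoundedVariationOn.intervalIntegrable (by rwa [Set.uIcc_of_le hab.le])
  have hgi' : IntervalIntegrable g' volume a b :=
    hgi.congr_ae (ae_restrict_of_ae (hae.mono fun x hx => hx.symm))
  have h1 := hasRSIntegral_of_hasDerivAt hab.le hfF hF hh hgi' hV
  have e1 : g' a = ga := by rw [hg', Function.update_of_ne hab.ne, Function.update_self]
  have e2 : g' b = gb := by rw [hg', Function.update_self]
  have e3 : ∫ x in a..b, h x * g' x = ∫ x in a..b, h x * g x :=
    intervalIntegral.integral_congr_ae (hae.mono fun x hx _ => by rw [hx])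
  rwa [e1, e2, e3] at h1

theorem BoundedVariationOn.exists_tendsto_nhdsGT {g : ℝ → ℝ} {a b : ℝ} (hab : a < b)
    (hg : BoundedVariationOn g (Set.Icc a b)) : ∃ l, Tendsto g (𝓝[>] a) (𝓝 l) := by
  obtain ⟨l, hl⟩ := (hg.mono Set.Ioo_subset_Icc_self).exists_tendsto_right a
  rw [Set.inter_eq_left.mpr fun x hx => hx.1, nhdsWithin_Ioo_eq_nhdsGT hab] at hl
  exact ⟨l, hl⟩

theorem BoundedVariationOn.exists_tendsto_nhdsLT {g : ℝ → ℝ} {a b : ℝ} (hab : a < b)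
    (hg : BoundedVariationOn g (Set.Icc a b)) : ∃ l, Tendsto g (𝓝[<] b) (𝓝 l) := by
  obtain ⟨l, hl⟩ := (hg.mono Set.Ioo_subset_Icc_self).exists_tendsto_left b
  rw [Set.inter_eq_left.mpr fun x hx => hx.2, nhdsWithin_Ioo_eq_nhdsLT hab] at hl
  exact ⟨l, hl⟩

/-! ### Fractional integration by parts -/

/-- The left- and right-sided fractional integrals are adjoint to each other. This is Fubini's
theorem for the kernel `(y - x)^(ρ-1)` on the triangle `x < y`; the integrability of the product is
that of a convolution of integrable functions. -/
theorem integral_mul_rightRL {ρ a b : ℝ} (hρ : 0 ≤ ρ) (hab : a ≤ b) {φ h : ℝ → ℝ}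
    (hφ : IntervalIntegrable φ volume a b) (hh : Continuous h) :
    ∫ x in a..b, φ x * rightRL ρ b h x = ∫ x in a..b, leftRL ρ a φ x * h x := by
  rcases hρ.eq_or_lt with rfl | hρ
  · simp [rightRL, leftRL]
  simp only [rightRL, leftRL, if_neg hρ.ne', mul_left_comm (φ _), mul_assoc,
    intervalIntegral.integral_const_mul]
  congr 1
  set κ : ℝ → ℝ := (Set.Ioc 0 (b - a)).indicator fun t => t ^ (ρ - 1) with hκ
  set φ₀ : ℝ → ℝ := (Set.Ioc a b).indicator φ with hφ₀
  set h₀ : ℝ → ℝ := (Set.Ioc a b).indicator h with hh₀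
  have iκ : Integrable κ := by
    rw [hκ, integrable_indicator_iff measurableSet_Ioc,
      ← intervalIntegrable_iff_integrableOn_Ioc_of_le (by linarith)]
    exact intervalIntegral.intervalIntegrable_rpow' (by linarith)
  have iφ : Integrable φ₀ := by
    rw [hφ₀, integrable_indicator_iff measurableSet_Ioc]
    exact (intervalIntegrable_iff_integrableOn_Ioc_of_le hab).mp hφ
  obtain ⟨C, hC⟩ := isCompact_Icc.exists_bound_of_continuousOn (hh.continuousOn (s := Set.Icc a b))
  have hC0 : 0 ≤ C := (norm_nonneg _).trans (hC a (Set.left_mem_Icc.mpr hab))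
  have hbd : ∀ y, ‖h₀ y‖ ≤ C := by
    intro y
    by_cases hy : y ∈ Set.Ioc a b
    · rw [hh₀, Set.indicator_of_mem hy]
      exact hC y (Set.Ioc_subset_Icc_self hy)
    · rw [hh₀, Set.indicator_of_notMem hy, norm_zero]
      exact hC0
  have hconv : Integrable (fun p : ℝ × ℝ => φ₀ p.2 * κ (p.1 - p.2)) (volume.prod volume) :=
    Integrable.convolution_integrand (ContinuousLinearMap.mul ℝ ℝ) iφ iκ
  have hprod : Integrable (Function.uncurry fun y x => h₀ y * (φ₀ x * κ (y - x)))
      (volume.prod volume) :=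
    hconv.bdd_mul (f := fun p : ℝ × ℝ => h₀ p.1)
      ((hh.measurable.indicator measurableSet_Ioc).comp measurable_fst).aestronglyMeasurable
      (Eventually.of_forall fun p => hbd p.1)
  have hswap := integral_integral_swap hprod
  -- The kernel and the indicators single out `Ioo a y` in `x` and `Ioc x b` in `y`.
  have hin : ∀ y ∈ Set.Ioc a b, ∫ x, φ₀ x * κ (y - x) = ∫ x in a..y, φ x * (y - x) ^ (ρ - 1) := by
    intro y hy
    rw [intervalIntegral.integral_of_le hy.1.le, integral_Ioc_eq_integral_Ioo,
      ← integral_indicator measurableSet_Ioo]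
    congr 1
    funext x
    by_cases hx : x ∈ Set.Ioo a y
    · rw [Set.indicator_of_mem hx, hφ₀, Set.indicator_of_mem
        (show x ∈ Set.Ioc a b from ⟨hx.1, hx.2.le.trans hy.2⟩), hκ,
        Set.indicator_of_mem (show y - x ∈ Set.Ioc 0 (b - a) from
          ⟨by linarith [hx.2], by linarith [hx.1, hy.2]⟩)]
    · rw [Set.indicator_of_notMem hx]
      by_cases hx1 : x ∈ Set.Ioc a b
      · rw [hκ, Set.indicator_of_notMem, mul_zero]
        exact fun h' => hx ⟨hx1.1, by linarith [h'.1]⟩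
      · rw [hφ₀, Set.indicator_of_notMem hx1, zero_mul]
  have hout : ∀ x ∈ Set.Ioc a b, ∫ y, h₀ y * κ (y - x) = ∫ y in x..b, h y * (y - x) ^ (ρ - 1) := by
    intro x hx
    rw [intervalIntegral.integral_of_le hx.2, ← integral_indicator measurableSet_Ioc]
    congr 1
    funext y
    by_cases hy : y ∈ Set.Ioc x b
    · rw [Set.indicator_of_mem hy, hh₀, Set.indicator_of_mem
        (show y ∈ Set.Ioc a b from ⟨hx.1.trans hy.1, hy.2⟩), hκ,
        Set.indicator_of_mem (show y - x ∈ Set.Ioc 0 (b - a) from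
          ⟨by linarith [hy.1], by linarith [hx.1, hy.2]⟩)]
    · rw [Set.indicator_of_notMem hy]
      by_cases hy1 : y ∈ Set.Ioc a b
      · rw [hκ, Set.indicator_of_notMem, mul_zero]
        exact fun h' => hy ⟨by linarith [h'.1], hy1.2⟩
      · rw [hh₀, Set.indicator_of_notMem hy1, zero_mul]
  have hL : ∫ y, ∫ x, h₀ y * (φ₀ x * κ (y - x)) =
      ∫ y in a..b, (∫ x in a..y, φ x * (y - x) ^ (ρ - 1)) * h y := by
    rw [intervalIntegral.integral_of_le hab, ← integral_indicator measurableSet_Ioc]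
    congr 1
    funext y
    rw [integral_const_mul]
    by_cases hy : y ∈ Set.Ioc a b
    · rw [hin y hy, hh₀, Set.indicator_of_mem hy, Set.indicator_of_mem hy, mul_comm]
    · rw [hh₀, Set.indicator_of_notMem hy, Set.indicator_of_notMem hy, zero_mul]
  have hR : ∫ x, ∫ y, h₀ y * (φ₀ x * κ (y - x)) =
      ∫ x in a..b, φ x * ∫ y in x..b, h y * (y - x) ^ (ρ - 1) := by
    rw [intervalIntegral.integral_of_le hab, ← integral_indicator measurableSet_Ioc]
    congr 1
    funext x
    simp only [mul_left_comm _ (φ₀ x)]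
    rw [integral_const_mul]
    by_cases hx : x ∈ Set.Ioc a b
    · rw [hout x hx, hφ₀, Set.indicator_of_mem hx, Set.indicator_of_mem hx]
    · rw [hφ₀, Set.indicator_of_notMem hx, Set.indicator_of_notMem hx, zero_mul]
  rw [← hR, ← hL, hswap]

theorem integral_mul_leftRL {ρ a b : ℝ} (hρ : 0 ≤ ρ) (hab : a ≤ b) {φ h : ℝ → ℝ}
    (hφ : IntervalIntegrable φ volume a b) (hh : Continuous h) :
    ∫ x in a..b, φ x * leftRL ρ a h x = ∫ x in a..b, rightRL ρ b φ x * h x := by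
  have hφ' : IntervalIntegrable (fun x => φ (-x)) volume (-b) (-a) := by
    simpa using (hφ.comp_sub_left 0).symm
  have h1 := integral_mul_rightRL hρ (neg_le_neg hab) hφ' (hh.comp continuous_neg)
  have hneg : ∀ w : ℝ → ℝ, ∫ x in a..b, w x = ∫ x in -b..-a, w (-x) := fun w => by
    rw [intervalIntegral.integral_comp_neg, neg_neg, neg_neg]
  rw [hneg, hneg]
  simp only [leftRL_eq_rightRL_comp_neg, neg_neg, Function.comp_def] at h1 ⊢
  exact h1

/-! ### Repeated integration by parts from an interior point -/

/-- Repeated integration by parts for absolutely continuous functions against iterated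
antiderivatives `R (j + 1)` that vanish at `a`. -/
theorem integral_mul_eq_sum_add_integral {f R : ℕ → ℝ → ℝ} {a b : ℝ} (k : ℕ)
    (hf : ∀ j < k, AbsolutelyContinuousOnInterval (f j) a b)
    (hf' : ∀ j < k, ∀ᵐ x, x ∈ Set.uIoc a b → deriv (f j) x = f (j + 1) x)
    (hR : ∀ j, AbsolutelyContinuousOnInterval (R (j + 1)) a b)
    (hR' : ∀ j x, HasDerivAt (R (j + 1)) (R j x) x) (ha : ∀ j, R (j + 1) a = 0) :
    ∫ x in a..b, f 0 x * R 0 x =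
      ∑ j ∈ Finset.range k, (-1) ^ j * (f j b * R (j + 1) b)
        + (-1) ^ k * ∫ x in a..b, f k x * R k x := by
  induction k with
  | zero => simp
  | succ k ih =>
    rw [ih (fun j hj => hf j (by lia)) (fun j hj => hf' j (by lia)), Finset.sum_range_succ]
    have h := (hf k (by lia)).integral_mul_deriv_eq_deriv_mul (hR k)
    rw [show deriv (R (k + 1)) = R k from funext fun x => (hR' k x).deriv, ha,
      intervalIntegral.integral_congr_ae (f := fun x => deriv (f k) x * R (k + 1) x)
        (g := fun x => f (k + 1) x * R (k + 1) x)
        ((hf' k (by lia)).mono fun x hx hx' => by rw [hx hx'])] at h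
    rw [h, pow_succ]
    ring

theorem iteratedDerivWithin_Icc_eq_iteratedDeriv (u : ℝ → ℝ) (j : ℕ) {a b x : ℝ}
    (hx : x ∈ Set.Ioo a b) : iteratedDerivWithin j u (Set.Icc a b) x = iteratedDeriv j u x := by
  induction j generalizing x with
  | zero => simp
  | succ j ih =>
    rw [iteratedDerivWithin_succ, iteratedDeriv_succ,
      derivWithin_of_mem_nhds (Icc_mem_nhds hx.1 hx.2)]
    refine Filter.EventuallyEq.deriv_eq ?_
    filter_upwards [Ioo_mem_nhds hx.1 hx.2] with y hy using ih hy

theorem deriv_iteratedDerivWithin_Icc (u : ℝ → ℝ) (j : ℕ) {a b x : ℝ} (hx : x ∈ Set.Ioo a b) :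
    deriv (iteratedDerivWithin j u (Set.Icc a b)) x =
      iteratedDerivWithin (j + 1) u (Set.Icc a b) x := by
  rw [iteratedDerivWithin_succ, derivWithin_of_mem_nhds (Icc_mem_nhds hx.1 hx.2)]

theorem ae_mem_Ioo_of_mem_Icc (a b : ℝ) : ∀ᵐ x, x ∈ Set.Icc a b → x ∈ Set.Ioo a b := by
  have : (({a, b} : Set ℝ)ᶜ) ∈ ae volume :=
    compl_mem_ae_iff.mpr (Set.Finite.measure_zero (Set.toFinite _) _)
  filter_upwards [this] with x hx hx'
  simp only [Set.mem_compl_iff, Set.mem_insert_iff, Set.mem_singleton_iff, not_or] at hx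
  exact ⟨lt_of_le_of_ne hx'.1 (Ne.symm hx.1), lt_of_le_of_ne hx'.2 hx.2⟩

/-- The boundary terms at `θ` of the integrations by parts over `[θ, 1]` and over `[-1, θ]` cancel:
their sum is a multiple of `∫ (x - θ)^j P_n(x) dx` over `[-1, 1]`. -/
theorem legendreFrac_add_reflect_eq_zero {n j : ℕ} (hj : j < n) {θ : ℝ}
    (hθ : θ ∈ Set.Ioo (-1 : ℝ) 1) :
    legendreFrac n (j + 1) θ + (-1) ^ j * ((-1) ^ n * legendreFrac n (j + 1) (-θ)) = 0 := by
  have h0 : (0 : ℝ) ≤ (j : ℝ) + 1 := by positivity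
  have h1 : (j : ℝ) + 1 ≠ 0 := by positivity
  have hdeg : ((Polynomial.X - Polynomial.C θ) ^ j : Polynomial ℝ).degree < n := by
    rw [Polynomial.degree_pow, Polynomial.degree_X_sub_C]
    simpa using hj
  have horth := integral_mul_legendreP_eq_zero n _ hdeg
  simp only [Polynomial.eval_pow, Polynomial.eval_sub, Polynomial.eval_X, Polynomial.eval_C]
    at horth
  have hc : Continuous fun x : ℝ => (x - θ) ^ j * legendreP n x :=
    ((continuous_id.sub continuous_const).pow j).mul (continuous_legendreP n)
  rw [← intervalIntegral.integral_add_adjacent_intervals (b := θ)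
    (hc.intervalIntegrable _ _) (hc.intervalIntegrable _ _)] at horth
  have hr : rightRL (j + 1) 1 (legendreP n) θ =
      1 / Real.Gamma (j + 1) * ∫ x in θ..1, (x - θ) ^ j * legendreP n x := by
    rw [rightRL, if_neg h1]
    congr 1
    refine intervalIntegral.integral_congr fun x _ => ?_
    simp only [add_sub_cancel_right, Real.rpow_natCast]
    ring
  have hl : leftRL (j + 1) (-1) (legendreP n) θ =
      1 / Real.Gamma (j + 1) * ((-1) ^ j * ∫ x in (-1 : ℝ)..θ, (x - θ) ^ j * legendreP n x) := by
    rw [leftRL, if_neg h1, ← intervalIntegral.integral_const_mul ((-1) ^ j)]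
    congr 1
    refine intervalIntegral.integral_congr fun x _ => ?_
    simp only [add_sub_cancel_right, Real.rpow_natCast]
    rw [← neg_sub x θ, neg_pow]
    ring
  rw [← rightRL_legendreP n h0 hθ.2.le, ← leftRL_legendreP n h0 hθ.1.le, hr, hl]
  have hsq : ((-1 : ℝ) ^ j) * (-1) ^ j = 1 := by rw [← mul_pow]; simp
  linear_combination (1 / Real.Gamma (j + 1)) * horth +
    (1 / Real.Gamma (j + 1)) * (∫ x in (-1 : ℝ)..θ, (x - θ) ^ j * legendreP n x) * hsq

/-- The derivative of order `k` of a function whose lower derivatives are absolutely continuous is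
integrable. -/
theorem intervalIntegrable_iteratedDeriv {k : ℕ} (hk : 1 ≤ k) {u : ℝ → ℝ} {a b c d : ℝ}
    (hac : a ≤ c) (hcd : c ≤ d) (hdb : d ≤ b)
    (hu : ∀ j < k, AbsolutelyContinuousOnInterval (iteratedDerivWithin j u (Set.Icc a b)) a b) :
    IntervalIntegrable (iteratedDeriv k u) volume c d := by
  have h := (hu (k - 1) (by lia)).intervalIntegrable_deriv
  have hsub : Set.uIcc c d ⊆ Set.uIcc a b := by
    rw [Set.uIcc_of_le hcd, Set.uIcc_of_le (hac.trans (hcd.trans hdb))]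
    exact Set.Icc_subset_Icc hac hdb
  refine (h.mono_set hsub).congr_ae ?_
  filter_upwards [ae_restrict_mem measurableSet_uIoc,
    ae_restrict_of_ae (ae_mem_Ioo_of_mem_Icc a b)] with x hx hx'
  have hx2 := hsub (Set.uIoc_subset_uIcc hx)
  rw [Set.uIcc_of_le (hac.trans (hcd.trans hdb))] at hx2
  rw [deriv_iteratedDerivWithin_Icc u _ (hx' hx2), Nat.sub_add_cancel hk,
    iteratedDerivWithin_Icc_eq_iteratedDeriv u k (hx' hx2)]

theorem ae_deriv_iteratedDerivWithin {u : ℝ → ℝ} {a b c d : ℝ} (j : ℕ) (hab : a ≤ b)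
    (hsub : Set.uIcc c d ⊆ Set.uIcc a b) :
    ∀ᵐ x, x ∈ Set.uIoc c d → deriv (iteratedDerivWithin j u (Set.Icc a b)) x =
      iteratedDerivWithin (j + 1) u (Set.Icc a b) x := by
  filter_upwards [ae_mem_Ioo_of_mem_Icc a b] with x hx hx'
  have := hsub (Set.uIoc_subset_uIcc hx')
  rw [Set.uIcc_of_le hab] at this
  exact deriv_iteratedDerivWithin_Icc u j (hx this)

/-- The part of the Legendre coefficient over `[θ, 1]`: `k` integrations by parts followed by a
fractional one of order `k - μ`, by `I_{1-}^k P_n = I_{1-}^{k-μ} I_{1-}^μ P_n`. -/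
theorem integral_mul_legendreP_right {k : ℕ} (hk : 1 ≤ k) {μ θ : ℝ} (hμ0 : 0 ≤ μ) (hμk : μ ≤ k)
    (hθ : θ ∈ Set.Ioo (-1 : ℝ) 1) {u : ℝ → ℝ}
    (hu : ∀ j < k, AbsolutelyContinuousOnInterval
      (iteratedDerivWithin j u (Set.Icc (-1 : ℝ) 1)) (-1) 1)
    {v : ℝ → ℝ} (hv : ∀ᵐ x, x ∈ Set.Ioo θ 1 → v x = leftCaputo k μ θ u x) (n : ℕ) :
    ∫ x in θ..1, u x * legendreP n x =
      ∑ j ∈ Finset.range k, iteratedDerivWithin j u (Set.Icc (-1 : ℝ) 1) θ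
          * legendreFrac n (j + 1) θ
        + ∫ x in θ..1, v x * legendreFrac n μ x := by
  have hsub : Set.uIcc 1 θ ⊆ Set.uIcc (-1 : ℝ) 1 := by
    rw [Set.uIcc_of_ge hθ.2.le, Set.uIcc_of_le (by norm_num)]
    exact Set.Icc_subset_Icc hθ.1.le le_rfl
  have h := integral_mul_eq_sum_add_integral (a := 1) (b := θ) k
    (f := fun j => iteratedDerivWithin j u (Set.Icc (-1 : ℝ) 1))
    (R := fun j x => (-1) ^ j * legendreFrac n j x)
    (fun j hj => (hu j hj).mono hsub)
    (fun j _ => ae_deriv_iteratedDerivWithin j (by norm_num) hsub)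
    (fun j => by
      rw [Nat.cast_succ]
      exact (absolutelyContinuousOnInterval_of_hasDerivAt
        (hasDerivAt_legendreFrac n j.cast_nonneg)
        (continuous_legendreFrac n j.cast_nonneg).neg 1 θ).const_mul _)
    (fun j x => by
      rw [Nat.cast_succ]
      refine ((hasDerivAt_legendreFrac n j.cast_nonneg x).const_mul _).congr_deriv ?_
      rw [pow_succ]
      ring)
    (fun j => by rw [legendreFrac_one n (by positivity), mul_zero])
  have hsq : ((-1 : ℝ) ^ k) * (-1) ^ k = 1 := by rw [← mul_pow]; simp
  simp only [mul_left_comm _ ((-1 : ℝ) ^ k), intervalIntegral.integral_const_mul] at h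
  rw [← mul_assoc, hsq, one_mul, intervalIntegral.integral_symm θ 1,
    intervalIntegral.integral_symm θ 1, neg_eq_iff_eq_neg] at h
  simp only [iteratedDerivWithin_zero, Nat.cast_zero, pow_zero, one_mul, legendreFrac_zero] at h
  rw [h, neg_add, neg_neg, ← Finset.sum_neg_distrib]
  congr 1
  · refine Finset.sum_congr rfl fun j _ => ?_
    have hsq : ((-1 : ℝ) ^ j) * (-1) ^ j = 1 := by rw [← mul_pow]; simp
    rw [Nat.cast_succ, pow_succ]
    linear_combination (iteratedDerivWithin j u (Set.Icc (-1) 1) θ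
      * legendreFrac n (j + 1) θ) * hsq
  · have hcongr : ∫ x in θ..1, iteratedDerivWithin k u (Set.Icc (-1) 1) x * legendreFrac n k x =
        ∫ x in θ..1, iteratedDeriv k u x * rightRL (k - μ) 1 (legendreFrac n μ) x := by
      refine intervalIntegral.integral_congr_ae ?_
      filter_upwards [ae_mem_Ioo_of_mem_Icc (-1) 1] with x hx hx'
      rw [Set.uIoc_of_le hθ.2.le] at hx'
      have hx2 := hx ⟨(hθ.1.trans hx'.1).le, hx'.2⟩
      rw [iteratedDerivWithin_Icc_eq_iteratedDeriv u k hx2,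
        rightRL_legendreFrac n (sub_nonneg.mpr hμk) hμ0 hx'.2, add_sub_cancel]
    rw [hcongr, integral_mul_rightRL (sub_nonneg.mpr hμk) hθ.2.le
      (intervalIntegrable_iteratedDeriv hk hθ.1.le hθ.2.le le_rfl hu)
      (continuous_legendreFrac n hμ0)]
    refine intervalIntegral.integral_congr_ae ?_
    filter_upwards [hv, ae_mem_Ioo_of_mem_Icc θ 1] with x hx hx' hx2
    rw [Set.uIoc_of_le hθ.2.le] at hx2
    rw [hx (hx' (Set.Ioc_subset_Icc_self hx2)), leftCaputo]

/-- The part of the Legendre coefficient over `[-1, θ]`; here `(-1)^n` times the reflection of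
`legendreFrac n ρ` represents `I_{-1+}^ρ P_n`. -/
theorem integral_mul_legendreP_left {k : ℕ} (hk : 1 ≤ k) {μ θ : ℝ} (hμ0 : 0 ≤ μ) (hμk : μ ≤ k)
    (hθ : θ ∈ Set.Ioo (-1 : ℝ) 1) {u : ℝ → ℝ}
    (hu : ∀ j < k, AbsolutelyContinuousOnInterval
      (iteratedDerivWithin j u (Set.Icc (-1 : ℝ) 1)) (-1) 1)
    {v : ℝ → ℝ} (hv : ∀ᵐ x, x ∈ Set.Ioo (-1) θ → v x = rightCaputo k μ θ u x) (n : ℕ) :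
    ∫ x in (-1 : ℝ)..θ, u x * legendreP n x =
      ∑ j ∈ Finset.range k, (-1) ^ j * (iteratedDerivWithin j u (Set.Icc (-1 : ℝ) 1) θ
          * ((-1) ^ n * legendreFrac n (j + 1) (-θ)))
        + ∫ x in (-1 : ℝ)..θ, v x * ((-1) ^ n * legendreFrac n μ (-x)) := by
  have hsub : Set.uIcc (-1) θ ⊆ Set.uIcc (-1 : ℝ) 1 := by
    rw [Set.uIcc_of_le hθ.1.le, Set.uIcc_of_le (by norm_num)]
    exact Set.Icc_subset_Icc le_rfl hθ.2.le
  have h := integral_mul_eq_sum_add_integral (a := -1) (b := θ) k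
    (f := fun j => iteratedDerivWithin j u (Set.Icc (-1 : ℝ) 1))
    (R := fun j x => (-1) ^ n * legendreFrac n j (-x))
    (fun j hj => (hu j hj).mono hsub)
    (fun j _ => ae_deriv_iteratedDerivWithin j (by norm_num) hsub)
    (fun j => by
      rw [Nat.cast_succ]
      exact absolutelyContinuousOnInterval_of_hasDerivAt
        (hasDerivAt_neg_one_pow_mul_legendreFrac_neg n j.cast_nonneg)
        (continuous_neg_one_pow_mul_legendreFrac_neg n j.cast_nonneg) _ _)
    (fun j x => by
      rw [Nat.cast_succ]
      exact hasDerivAt_neg_one_pow_mul_legendreFrac_neg n j.cast_nonneg x)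
    (fun j => by rw [neg_neg, legendreFrac_one n (by positivity), mul_zero])
  simp only [iteratedDerivWithin_zero, Nat.cast_zero, legendreFrac_zero, Nat.cast_succ,
    ← legendreP_neg, neg_neg] at h
  rw [h]
  congr 1
  have hcongr : ∫ x in (-1 : ℝ)..θ, iteratedDerivWithin k u (Set.Icc (-1) 1) x *
        ((-1) ^ n * legendreFrac n k (-x)) =
      ∫ x in (-1 : ℝ)..θ, iteratedDeriv k u x *
        leftRL (k - μ) (-1) (fun x => (-1) ^ n * legendreFrac n μ (-x)) x := by
    refine intervalIntegral.integral_congr_ae ?_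
    filter_upwards [ae_mem_Ioo_of_mem_Icc (-1) 1] with x hx hx'
    rw [Set.uIoc_of_le hθ.1.le] at hx'
    have hx2 := hx ⟨hx'.1.le, hx'.2.trans hθ.2.le⟩
    rw [iteratedDerivWithin_Icc_eq_iteratedDeriv u k hx2, leftRL_eq_rightRL_comp_neg, neg_neg]
    simp only [neg_neg]
    rw [rightRL_const_mul, rightRL_legendreFrac n (sub_nonneg.mpr hμk) hμ0 (by linarith [hx2.1]),
      add_sub_cancel]
  rw [hcongr, integral_mul_leftRL (sub_nonneg.mpr hμk) hθ.1.le
    (intervalIntegrable_iteratedDeriv hk le_rfl hθ.1.le hθ.2.le hu)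
    (continuous_neg_one_pow_mul_legendreFrac_neg n hμ0),
    ← intervalIntegral.integral_const_mul]
  refine intervalIntegral.integral_congr_ae ?_
  filter_upwards [hv, ae_mem_Ioo_of_mem_Icc (-1) θ] with x hx hx' hx2
  rw [Set.uIoc_of_le hθ.1.le] at hx2
  rw [hx (hx' (Set.Ioc_subset_Icc_self hx2)), rightCaputo, mul_assoc]

/-! ### Legendre coefficients through Caputo derivatives -/

theorem mainTheorem2 (k : ℕ) (hk : 1 ≤ k) (μ θ : ℝ)
    (hμ : μ ∈ Set.Ioc ((k : ℝ) - 1) (k : ℝ)) (hθ : θ ∈ Set.Ioo (-1 : ℝ) 1)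
    (u : ℝ → ℝ)
    (hu : ∀ j < k, AbsolutelyContinuousOnInterval
      (iteratedDerivWithin j u (Set.Icc (-1 : ℝ) 1)) (-1) 1)
    -- `vp`, `vm` are the Caputo derivatives of `u`, as functions of bounded variation
    (vp vm : ℝ → ℝ)
    (hvp : BoundedVariationOn vp (Set.Icc θ 1))
    (hvp_eq : ∀ᵐ x, x ∈ Set.Ioo θ 1 → vp x = leftCaputo k μ θ u x)
    (hvm : BoundedVariationOn vm (Set.Icc (-1) θ))
    (hvm_eq : ∀ᵐ x, x ∈ Set.Ioo (-1) θ → vm x = rightCaputo k μ θ u x)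
    (n : ℕ) (hn : μ + 1 ≤ (n : ℝ)) :
    (∃ cp cm Jp Jm : ℝ,
      Tendsto vp (𝓝[>] θ) (𝓝 cp) ∧ Tendsto vm (𝓝[<] θ) (𝓝 cm) ∧
      HasStieltjesIntegral (rightRL (μ + 1) 1 (legendreP n)) vp θ 1 Jp ∧
      HasStieltjesIntegral (leftRL (μ + 1) (-1) (legendreP n)) vm (-1) θ Jm ∧
      legendreCoeff u n = (2 * n + 1) / 2 *
        (rightRL (μ + 1) 1 (legendreP n) θ * cp + Jp
          + leftRL (μ + 1) (-1) (legendreP n) θ * cm - Jm)) ∧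
    jacobiP n (μ + 1) (-μ - 1) 1 ≠ 0 ∧
    ∀ x ∈ Set.Icc (-1 : ℝ) 1,
      rightRL (μ + 1) 1 (legendreP n) x =
        (1 - x) ^ (μ + 1) / Real.Gamma (μ + 2) *
          (jacobiP n (μ + 1) (-μ - 1) x / jacobiP n (μ + 1) (-μ - 1) 1) ∧
      leftRL (μ + 1) (-1) (legendreP n) x =
        (1 + x) ^ (μ + 1) / Real.Gamma (μ + 2) *
          (jacobiP n (-μ - 1) (μ + 1) x / jacobiP n (μ + 1) (-μ - 1) 1) := by
  have hkμ : (1 : ℝ) ≤ k := by exact_mod_cast hk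
  have hμ0 : 0 ≤ μ := by linarith [hμ.1]
  have hμ1 : 0 ≤ μ + 1 := by linarith
  have hkn : k < n := by
    have : (k : ℝ) < n := by linarith [hμ.1]
    exact_mod_cast this
  have hα : -μ - 1 = -(μ + 1) := by ring
  have hΓ : μ + 2 = μ + 1 + 1 := by ring
  refine ⟨?_, (jacobiP_one_pos n (by linarith) _).ne', fun x hx => ⟨?_, ?_⟩⟩
  -- Both Stieltjes integrals are given by integration by parts; the boundary terms at `1` and `-1`
  -- vanish, and those at `θ` are the terms in `cp` and `cm`.
  · obtain ⟨cp, hcp⟩ := hvp.exists_tendsto_nhdsGT hθ.2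
    obtain ⟨dp, hdp⟩ := hvp.exists_tendsto_nhdsLT hθ.2
    obtain ⟨cm, hcm⟩ := hvm.exists_tendsto_nhdsLT hθ.1
    obtain ⟨dm, hdm⟩ := hvm.exists_tendsto_nhdsGT hθ.1
    have hJp := hvp.hasStieltjesIntegral hθ.2 hcp hdp (f := rightRL (μ + 1) 1 (legendreP n))
      (F := legendreFrac n (μ + 1)) (h := fun x => -legendreFrac n μ x)
      (fun x hx => rightRL_legendreP n hμ1 hx.2) (hasDerivAt_legendreFrac n hμ0)
      (continuous_legendreFrac n hμ0).neg
    have hJm := hvm.hasStieltjesIntegral hθ.1 hdm hcm (f := leftRL (μ + 1) (-1) (legendreP n))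
      (F := fun x => (-1) ^ n * legendreFrac n (μ + 1) (-x))
      (h := fun x => (-1) ^ n * legendreFrac n μ (-x))
      (fun x hx => leftRL_legendreP n hμ1 hx.1)
      (hasDerivAt_neg_one_pow_mul_legendreFrac_neg n hμ0)
      (continuous_neg_one_pow_mul_legendreFrac_neg n hμ0)
    refine ⟨cp, cm, _, _, hcp, hcm, hJp, hJm, ?_⟩
    have hcu : ContinuousOn (fun x => u x * legendreP n x) (Set.uIcc (-1) 1) := by
      have := (hu 0 (by lia)).continuousOn
      rw [iteratedDerivWithin_zero] at this
      exact this.mul (continuous_legendreP n).continuousOn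
    have hθI : θ ∈ Set.uIcc (-1 : ℝ) 1 := by
      rw [Set.uIcc_of_le (by norm_num)]
      exact Set.Ioo_subset_Icc_self hθ
    have hr := integral_mul_legendreP_right hk hμ0 hμ.2 hθ hu hvp_eq n
    have hl := integral_mul_legendreP_left hk hμ0 hμ.2 hθ hu hvm_eq n
    -- The classical boundary terms at `θ` cancel because of the orthogonality of `P_n`; `k < n` is
    -- used here.
    have hcancel : ∑ j ∈ Finset.range k, (-1) ^ j *
          (iteratedDerivWithin j u (Set.Icc (-1 : ℝ) 1) θ
            * ((-1) ^ n * legendreFrac n (j + 1) (-θ)))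
        + ∑ j ∈ Finset.range k, iteratedDerivWithin j u (Set.Icc (-1 : ℝ) 1) θ
            * legendreFrac n (j + 1) θ = 0 := by
      rw [← Finset.sum_add_distrib]
      refine Finset.sum_eq_zero fun j hj => ?_
      have := legendreFrac_add_reflect_eq_zero ((Finset.mem_range.mp hj).trans hkn) hθ
      linear_combination iteratedDerivWithin j u (Set.Icc (-1 : ℝ) 1) θ * this
    have hR1 : rightRL (μ + 1) 1 (legendreP n) 1 = 0 := by
      rw [rightRL_legendreP n hμ1 le_rfl, legendreFrac_one n (by linarith)]
    have hL1 : leftRL (μ + 1) (-1) (legendreP n) (-1) = 0 := by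
      rw [leftRL_legendreP n hμ1 le_rfl, neg_neg, legendreFrac_one n (by linarith), mul_zero]
    rw [legendreCoeff, ← intervalIntegral.integral_add_adjacent_intervals (b := θ)
      (hcu.mono (Set.uIcc_subset_uIcc_left hθI)).intervalIntegrable
      (hcu.mono (Set.uIcc_subset_uIcc_right hθI)).intervalIntegrable, hr, hl, hR1, hL1]
    simp only [neg_mul, intervalIntegral.integral_neg, mul_comm (vp _), mul_comm (vm _)]
    linear_combination ((2 * (n : ℝ) + 1) / 2) * hcancel
  · rw [rightRL_legendreP n hμ1 hx.2, legendreFrac_eq_jacobiP n hμ1 hx.2, hα, hΓ]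
  · rw [leftRL_legendreP n hμ1 hx.1, legendreFrac_eq_jacobiP n hμ1 (by linarith [hx.1]), hα, hΓ,
      jacobiP_neg, sub_neg_eq_add]
    have : ((-1 : ℝ) ^ n) * (-1) ^ n = 1 := by rw [← mul_pow]; simp
    linear_combination ((1 + x) ^ (μ + 1) / Real.Gamma (μ + 1 + 1) *
      (jacobiP n (-(μ + 1)) (μ + 1) x / jacobiP n (μ + 1) (-(μ + 1)) 1)) * this
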